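/- **Model.** Time is divided into slots $1,2,3,\dots$ on a multiple-access channel. Nodes, each with one message, join the system at the beginning of slots. In each slot each node in the system broadcasts its message or stays idle. The slot is successful if it is not jammed and exactly one node broadcasts; the successful node then leaves the system. Every node in the system hears the same feedback, which only tells whether the slot was successful (no collision detection). A contention resolution algorithm $\mathcal A$ is a randomized rule, run independently by all nodes, which decides in each slot whether the node broadcasts from the node's private randomness and the feedback heard since its arrival (nodes have no identifiers and no global clock). An adaptive adversary strategy is a possibly randomized rule that decides in each slot, from the feedback of all earlier slots, how many nodes to inject and whether to jam the slot; its randomness is independent of that of the nodes. A slot is active if at least one node is in the system in it. Let $n_t$, $d_t$ and $a_t$ be the number of nodes that arrived, of jammed slots and of active slots, respectively, in the first $t$ slots. **$(f,g)$-throughput.** Let $f,g:\mathbb R^+\to\mathbb R^+$. $\mathcal A$ achieves $(f,g)$-throughput if, for every integer $t\ge 1$ and every adaptive adversary strategy, $a_t\le n_t\cdot f(t)+d_t\cdot g(t)$ with high probability in $n_t$, that is: there is a constant $c\ge 1$ such that for every integer $t\ge1$, every adaptive adversary strategy and every integer $n\ge 1$, $$\Pr\big[\,n_t=n\ \text{ and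 }\ a_t> n_t f(t)+d_t g(t)\,\big]\le \frac1{n^{c}} .$$ **Sub-logarithmic.** A function $h:\mathbb R^+\to\mathbb R$ is sub-logarithmic if (1) $h$ is non-decreasing and $h(x)\in O(\log x)$ as $x\to\infty$; (2) there are constants $y_0>0$ and $x_0$ with $h(x)\ge y_0$ for all $x\ge x_0$; (3) for every constant $c>0$ there is a constant $c_0$ with $|h(cn)-h(n)|\le c_0$ for all integers $n\ge1$; (4) for every constant $c>0$, $h(x^c)\in\Theta(h(x))$ as $x\to\infty$. **Theorem (Impossibility Result).** Let $f,g:\mathbb R^+\to\mathbb R^+$ be such that $f$ and $\log^2 g$ (that is, $x\mapsto(\log g(x))^2$) are both sub-logarithmic. If $f(x)\in o\!\left(\dfrac{\log x}{\log^2 g(x)}\right)$ as $x\to\infty$, then there does not exist any contention resolution algorithm without collision detection that achieves $(f,g)$-throughput. -/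

import Mathlib

open MeasureTheory Filter Asymptotics

universe u

/-- `f` is sub-logarithmic: (1) it is non-decreasing on the positive reals and `O(log x)`;
(2) it is eventually bounded below by a positive constant; (3) for every constant `c > 0` the
difference `|f (c n) - f n|` is bounded over the positive integers `n`; (4) `f (x ^ c) = Θ(f x)`
for every constant `c > 0`. -/
structure SubLogarithmic (f : ℝ → ℝ) : Prop where
  isBigO_log : f =O[atTop] Real.log
  monotoneOn : MonotoneOn f (Set.Ioi 0)
  eventually_ge : ∃ y₀ : ℝ, 0 < y₀ ∧ ∃ x₀ : ℝ, ∀ x : ℝ, x₀ ≤ x → y₀ ≤ f x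
  scaling : ∀ c : ℝ, 0 < c → ∃ c₀ : ℝ, ∀ n : ℕ, 1 ≤ n → |f (c * n) - f n| ≤ c₀
  power : ∀ c : ℝ, 0 < c → (fun x : ℝ => f (x ^ c)) =Θ[atTop] f

/-- A (randomized) contention resolution algorithm without collision detection.  On arrival a node
draws a private random seed.  In each slot it decides whether to broadcast its message, as a
function of its seed and of the channel feedback it has heard since its arrival, oldest slot first.
The feedback of a slot is one bit: `true` if a message was successfully transmitted, and `false`
otherwise, so that silence, collision and jamming cannot be told apart.  A node has no identifier
and no access to a global clock (it knows its age, which is the length of the list). -/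
structure Algorithm where
  Seed : Type u
  [seedSpace : MeasurableSpace Seed]
  law : Measure Seed
  [isProbabilityMeasure : IsProbabilityMeasure law]
  broadcast : Seed → List Bool → Bool
  measurable_broadcast : ∀ h : List Bool, Measurable fun s => broadcast s h

attribute [instance] Algorithm.seedSpace Algorithm.isProbabilityMeasure

/-- A (randomized) adaptive adversary strategy.  In each slot, from its own random seed and from the
channel feedback of all earlier slots (oldest first), the adversary determines how many new nodes
to inject at the beginning of the slot and whether to jam the slot. -/
structure Adversary where
  Seed : Type
  [seedSpace : MeasurableSpace Seed]
  law : Measure Seed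
  [isProbabilityMeasure : IsProbabilityMeasure law]
  inject : Seed → List Bool → ℕ
  jam : Seed → List Bool → Bool
  measurable_inject : ∀ h : List Bool, Measurable fun s => inject s h
  measurable_jam : ∀ h : List Bool, Measurable fun s => jam s h

attribute [instance] Adversary.seedSpace Adversary.isProbabilityMeasure

/-- The state of the system between two slots. -/
structure SystemState where
  /-- channel feedback of all elapsed slots, oldest first -/
  feedback : List Bool
  /-- number of nodes that have arrived so far; they are labelled `0, 1, 2, …` -/
  arrived : ℕ
  /-- number of slots jammed so far -/
  jammed : ℕ
  /-- number of elapsed slots in which at least one node was in the system -/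
  active : ℕ
  /-- the nodes in the system, as pairs (label, number of slots that elapsed before its arrival) -/
  nodes : Finset (ℕ × ℕ)

/-- The state before the first slot. -/
def SystemState.init : SystemState := ⟨[], 0, 0, 0, ∅⟩

section Execution

variable (A : Algorithm.{u}) (E : Adversary)

/-- The nodes in the system during the next slot: those present, and the newly injected ones. -/
def nodesInSlot (σ : E.Seed) (S : SystemState) : Finset (ℕ × ℕ) :=
  S.nodes ∪ (Finset.Ico S.arrived (S.arrived + E.inject σ S.feedback)).image
    fun i => (i, S.feedback.length)

/-- The nodes that broadcast in the next slot.  The node with label `i` uses the seed `ω i` and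
the feedback since its arrival. -/
def broadcasters (ω : ℕ → A.Seed) (σ : E.Seed) (S : SystemState) : Finset (ℕ × ℕ) :=
  (nodesInSlot E σ S).filter fun p => A.broadcast (ω p.1) (S.feedback.drop p.2) = true

/-- The next slot is successful: it is not jammed and exactly one node broadcasts. -/
def slotSuccess (ω : ℕ → A.Seed) (σ : E.Seed) (S : SystemState) : Bool :=
  !(E.jam σ S.feedback) && decide ((broadcasters A E ω σ S).card = 1)

/-- One slot of the execution; a node whose message is transmitted leaves the system. -/
def slotStep (ω : ℕ → A.Seed) (σ : E.Seed) (S : SystemState) : SystemState where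
  feedback := S.feedback ++ [slotSuccess A E ω σ S]
  arrived := S.arrived + E.inject σ S.feedback
  jammed := S.jammed + if E.jam σ S.feedback = true then 1 else 0
  active := S.active + if (nodesInSlot E σ S).Nonempty then 1 else 0
  nodes := if slotSuccess A E ω σ S = true then nodesInSlot E σ S \ broadcasters A E ω σ S
    else nodesInSlot E σ S

/-- The state after the first `t` slots, given the seeds of the nodes and of the adversary. -/
def stateAfter (ω : ℕ → A.Seed) (σ : E.Seed) : ℕ → SystemState
  | 0 => SystemState.init
  | t + 1 => slotStep A E ω σ (stateAfter ω σ t)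

/-- All the randomness: the seeds of the nodes are independent with the law of the algorithm, and
independent of the seed of the adversary. -/
noncomputable def executionLaw : Measure ((ℕ → A.Seed) × E.Seed) :=
  (Measure.infinitePi fun _ : ℕ => A.law).prod E.law

end Execution

/-- `A` achieves `(f, g)`-throughput: for every `t ≥ 1` and every adaptive adversary, with high
probability in the number `n_t` of arrivals in the first `t` slots, the number of active slots among
them is at most `n_t f(t) + d_t g(t)`, where `d_t` is the number of jammed ones.  As `n_t` may be
random, high probability in `n_t` means here that for every `n ≥ 1`, the probability that `n_t = n`
and that the bound fails is at most `1 / n ^ c`. -/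
def AchievesThroughput (A : Algorithm.{u}) (f g : ℝ → ℝ) : Prop :=
  ∃ c : ℝ, 1 ≤ c ∧ ∀ t : ℕ, 1 ≤ t → ∀ E : Adversary, ∀ n : ℕ, 1 ≤ n →
    (executionLaw A E).real {x | (stateAfter A E x.1 x.2 t).arrived = n ∧
      ¬ ((stateAfter A E x.1 x.2 t).active : ℝ) ≤
        (stateAfter A E x.1 x.2 t).arrived * f t + (stateAfter A E x.1 x.2 t).jammed * g t} ≤
      1 / (n : ℝ) ^ c

/-! Until the first success a node hears only `false`, so its behaviour is governed by its seed and
age alone, and deterministic adversaries suffice. On the event of no success every slot since the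
first arrival is active; throughput therefore makes this event improbable whenever the allowed bound
is smaller than the elapsed time (`AchievesThroughput.measureReal_noSuccess_le`).

This forces a lone node to broadcast often. With `g ≤ R / 16`, the adversary can afford to jam the
ages below `m` and any `m` ages of the window `[m, R m)`. If a node broadcast at most `r` times in
the window with probability above `1 / 2`, a random choice of those `m` ages would block it too
often. Hence each window carries `r / 2` expected broadcasts
(`AchievesThroughput.sum_silentProb_window_ge`), and `4 r` windows carry `2 r ^ 2`
(`AchievesThroughput.sum_silentProb_ge`).

Frequent broadcasting is fatal when many nodes are present. Let one node arrive at a random slot of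
each block of `b ≥ 4 f` slots, and jam an initial stretch until all these ages occur. From then on
the expected number of broadcasters is at least `2 r ^ 2 / b` in every slot, so exactly one
broadcaster has probability at most `2 exp (-r ^ 2 / b)` (`sum_measureReal_success_le`). A union
bound then contradicts throughput (`not_achievesThroughput_of_bounds`). With `r` of order `log t /
log R`, this needs `log t` to exceed a large multiple of `b (log R) ^ 2`, which is the little-o
hypothesis. -/

/-! ### Oblivious adversaries and executions without success -/

/-- The deterministic adversary that injects `n` nodes, node `i` at the beginning of the slot
with index `arr i`, and jams the slots selected by `jam`. -/
noncomputable def obliviousAdversary (n : ℕ) (arr : ℕ → ℕ) (jam : ℕ → Bool) : Adversary where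
  Seed := Unit
  law := Measure.dirac ()
  inject := fun _ h => ((Finset.range n).filter fun i => arr i = h.length).card
  jam := fun _ h => jam h.length
  measurable_inject := fun _ => measurable_const
  measurable_jam := fun _ => measurable_const

/-- The nodes that would broadcast in slot `τ` if no earlier slot were successful. -/
def silentBroadcasters (A : Algorithm.{u}) (n : ℕ) (arr : ℕ → ℕ) (ω : ℕ → A.Seed) (τ : ℕ) :
    Finset ℕ :=
  (Finset.range n).filter fun i =>
    arr i ≤ τ ∧ A.broadcast (ω i) (List.replicate (τ - arr i) false) = true

/-- No success occurs in the first `t` slots. -/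
def NoSuccess (A : Algorithm.{u}) (n : ℕ) (arr : ℕ → ℕ) (jam : ℕ → Bool) (t : ℕ)
    (ω : ℕ → A.Seed) : Prop :=
  ∀ τ < t, jam τ = true ∨ (silentBroadcasters A n arr ω τ).card ≠ 1

theorem filter_arrival_lt_eq_range {n : ℕ} {arr : ℕ → ℕ} (harr : Monotone arr) (t : ℕ) :
    (Finset.range n).filter (fun i => arr i < t) =
      Finset.range ((Finset.range n).filter fun i => arr i < t).card := by
  classical
  set s := (Finset.range n).filter fun i => arr i < t with hs
  have hdown : ∀ i ∈ s, Finset.range (i + 1) ⊆ s := by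
    intro i hi j hj
    simp only [hs, Finset.mem_filter, Finset.mem_range] at hi hj ⊢
    exact ⟨by omega, lt_of_le_of_lt (harr (by omega)) hi.2⟩
  apply Finset.eq_of_subset_of_card_le
  · intro i hi
    have := Finset.card_le_card (hdown i hi)
    simp only [Finset.card_range] at this
    simp only [Finset.mem_range]
    omega
  · simp

/-- The system labels nodes in order of arrival. For monotone `arr` these labels agree with the
indices, so node `i` uses seed `ω i`. -/
theorem Ico_arrival_eq_filter {n : ℕ} {arr : ℕ → ℕ} (harr : Monotone arr) (t : ℕ) :
    Finset.Ico ((Finset.range n).filter fun i => arr i < t).card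
        (((Finset.range n).filter fun i => arr i < t).card +
          ((Finset.range n).filter fun i => arr i = t).card) =
      (Finset.range n).filter fun i => arr i = t := by
  have hcard : ((Finset.range n).filter fun i => arr i < t).card +
      ((Finset.range n).filter fun i => arr i = t).card =
      ((Finset.range n).filter fun i => arr i < t + 1).card := by
    rw [← Finset.card_union_of_disjoint]
    · congr 1
      ext i
      simp only [Finset.mem_union, Finset.mem_filter, Finset.mem_range]
      omega
    · rw [Finset.disjoint_filter]
      intro i _ h
      omega
  rw [hcard]
  ext i
  have h1 := Finset.ext_iff.1 (filter_arrival_lt_eq_range (n := n) harr t) i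
  have h2 := Finset.ext_iff.1 (filter_arrival_lt_eq_range (n := n) harr (t + 1)) i
  simp only [Finset.mem_range, Finset.mem_filter] at h1 h2
  simp only [Finset.mem_Ico, Finset.mem_filter, Finset.mem_range]
  omega

/-- The state after `t` slots without success. -/
noncomputable def silentState (n : ℕ) (arr : ℕ → ℕ) (jam : ℕ → Bool) (t : ℕ) : SystemState where
  feedback := List.replicate t false
  arrived := ((Finset.range n).filter fun i => arr i < t).card
  jammed := ((Finset.range t).filter fun τ => jam τ = true).card
  active := ((Finset.range t).filter fun τ => ∃ i < n, arr i ≤ τ).card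
  nodes := ((Finset.range n).filter fun i => arr i < t).image fun i => (i, arr i)

theorem card_filter_range_succ (p : ℕ → Prop) [DecidablePred p] (t : ℕ) :
    ((Finset.range (t + 1)).filter p).card =
      ((Finset.range t).filter p).card + if p t then 1 else 0 := by
  rw [Finset.range_add_one, Finset.filter_insert]
  split_ifs with h
  · rw [Finset.card_insert_of_notMem (by simp)]
  · rfl

theorem nodesInSlot_silentState {n : ℕ} {arr : ℕ → ℕ} (harr : Monotone arr) (jam : ℕ → Bool)
    (σ : (obliviousAdversary n arr jam).Seed) (t : ℕ) :
    nodesInSlot (obliviousAdversary n arr jam) σ (silentState n arr jam t) =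
      ((Finset.range n).filter fun i => arr i < t + 1).image fun i => (i, arr i) := by
  have h := Ico_arrival_eq_filter (n := n) harr t
  unfold nodesInSlot
  simp only [silentState, obliviousAdversary, List.length_replicate]
  rw [h]
  ext ⟨i, s⟩
  simp only [Finset.mem_union, Finset.mem_image, Finset.mem_filter, Finset.mem_range,
    Prod.mk.injEq]
  constructor
  · rintro (⟨j, ⟨h1, h2⟩, rfl, rfl⟩ | ⟨j, ⟨h1, h2⟩, rfl, rfl⟩)
    · exact ⟨j, ⟨h1, by omega⟩, rfl, rfl⟩
    · exact ⟨j, ⟨h1, by omega⟩, rfl, h2⟩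
  · rintro ⟨j, ⟨h1, h2⟩, rfl, rfl⟩
    rcases Nat.lt_succ_iff_lt_or_eq.1 h2 with h3 | h3
    · exact Or.inl ⟨j, ⟨h1, h3⟩, rfl, rfl⟩
    · exact Or.inr ⟨j, ⟨h1, h3⟩, rfl, h3.symm⟩

theorem card_broadcasters_silentState (A : Algorithm.{u}) {n : ℕ} {arr : ℕ → ℕ}
    (harr : Monotone arr) (jam : ℕ → Bool) (ω : ℕ → A.Seed)
    (σ : (obliviousAdversary n arr jam).Seed) (t : ℕ) :
    (broadcasters A (obliviousAdversary n arr jam) ω σ (silentState n arr jam t)).card =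
      (silentBroadcasters A n arr ω t).card := by
  unfold broadcasters
  rw [nodesInSlot_silentState harr, Finset.filter_image, Finset.card_image_of_injective,
    Finset.filter_filter]
  · congr 1
    ext i
    simp only [silentBroadcasters, silentState, Finset.mem_filter, List.drop_replicate,
      Nat.lt_succ_iff]
  · intro i j h
    exact (Prod.mk.inj h).1

theorem stateAfter_eq_silentState (A : Algorithm.{u}) {n : ℕ} {arr : ℕ → ℕ}
    (harr : Monotone arr) (jam : ℕ → Bool) (ω : ℕ → A.Seed)
    (σ : (obliviousAdversary n arr jam).Seed) (t : ℕ) (h : NoSuccess A n arr jam t ω) :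
    stateAfter A (obliviousAdversary n arr jam) ω σ t = silentState n arr jam t := by
  induction t with
  | zero => simp [stateAfter, SystemState.init, silentState]
  | succ t ih =>
    have ht := ih fun τ hτ => h τ (by omega)
    have hnodes := nodesInSlot_silentState harr jam σ t
    have hfail : slotSuccess A (obliviousAdversary n arr jam) ω σ (silentState n arr jam t)
        = false := by
      unfold slotSuccess
      rw [card_broadcasters_silentState A harr]
      have hjam : (obliviousAdversary n arr jam).jam σ (silentState n arr jam t).feedback
          = jam t := by
        simp [obliviousAdversary, silentState]
      rw [hjam]
      rcases h t (by omega) with h1 | h1 <;> simp [h1]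
    have hne : (nodesInSlot (obliviousAdversary n arr jam) σ (silentState n arr jam t)).Nonempty ↔
        ∃ i < n, arr i ≤ t := by
      rw [hnodes]
      simp [Finset.Nonempty]
    rw [stateAfter, ht, slotStep, hfail]
    simp only [hnodes]
    rw [hnodes] at hne
    unfold silentState
    congr 1
    · simp [List.replicate_succ']
    · simp only [obliviousAdversary, List.length_replicate]
      rw [← Finset.card_union_of_disjoint]
      · congr 1
        ext i
        simp only [Finset.mem_union, Finset.mem_filter, Finset.mem_range]
        omega
      · rw [Finset.disjoint_filter]
        intro i _ h
        omega
    · simp only [obliviousAdversary, List.length_replicate]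
      exact (card_filter_range_succ (fun τ => jam τ = true) t).symm
    · rw [card_filter_range_succ]
      exact congrArg _ (if_congr hne rfl rfl)

theorem le_card_active {n : ℕ} (hn : 1 ≤ n) (arr : ℕ → ℕ) (t : ℕ) :
    t - arr 0 ≤ ((Finset.range t).filter fun τ => ∃ i < n, arr i ≤ τ).card := by
  calc t - arr 0 = (Finset.Ico (arr 0) t).card := by simp
    _ ≤ _ := by
      apply Finset.card_le_card
      intro τ hτ
      simp only [Finset.mem_Ico, Finset.mem_filter, Finset.mem_range] at hτ ⊢
      exact ⟨hτ.2, 0, by omega, hτ.1⟩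

theorem measurableSet_broadcast (A : Algorithm.{u}) (h : List Bool) :
    MeasurableSet {s | A.broadcast s h = true} :=
  A.measurable_broadcast h (measurableSet_singleton true)

/-- Throughput makes it unlikely that no node succeeds, as long as the bound on the number of active
slots is below the number of slots that have elapsed since the first arrival. -/
theorem AchievesThroughput.measureReal_noSuccess_le {A : Algorithm.{u}} {f g : ℝ → ℝ}
    (hA : AchievesThroughput A f g) {n t : ℕ} {arr : ℕ → ℕ} (hn : 1 ≤ n) (harr : Monotone arr)
    (harr_lt : ∀ i < n, arr i < t) (jam : ℕ → Bool)
    (hlt : n * f t + ((Finset.range t).filter fun τ => jam τ = true).card * g t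
      < (t : ℝ) - arr 0) :
    (Measure.infinitePi fun _ : ℕ => A.law).real {ω | NoSuccess A n arr jam t ω} ≤ 1 / n := by
  obtain ⟨c, hc, hbound⟩ := hA
  have ht : 1 ≤ t := by have := harr_lt 0 (by omega); omega
  have hb := hbound t ht (obliviousAdversary n arr jam) n hn
  set E := obliviousAdversary n arr jam
  have hn' : (1 : ℝ) ≤ n := by exact_mod_cast hn
  -- Since `c ≥ 1`, the weaker bound `1 / n` is available, and it is all that is needed.
  have hpow : 1 / (n : ℝ) ^ c ≤ 1 / n := by
    apply one_div_le_one_div_of_le (by linarith)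
    simpa using Real.rpow_le_rpow_of_exponent_le hn' hc
  refine le_trans ?_ (hb.trans hpow)
  have hset : {ω | NoSuccess A n arr jam t ω} =
      ⋂ τ ∈ Finset.range t, {ω | jam τ = true ∨ (silentBroadcasters A n arr ω τ).card ≠ 1} := by
    ext ω
    simp [NoSuccess]
  have hmeas : MeasurableSet {ω | NoSuccess A n arr jam t ω} := by
    rw [hset]
    refine Finset.measurableSet_biInter _ fun τ _ => ?_
    have hcard : Measurable fun ω => (silentBroadcasters A n arr ω τ).card := by
      simp only [silentBroadcasters, Finset.card_filter]
      refine Finset.measurable_sum _ fun i _ => Measurable.ite ?_ measurable_const measurable_const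
      by_cases hi : arr i ≤ τ
      · simp only [hi, true_and]
        exact (measurableSet_broadcast A (List.replicate (τ - arr i) false)).preimage
          (measurable_pi_apply i)
      · simp [hi]
    exact (MeasurableSet.const _).union (hcard (measurableSet_singleton 1).compl)
  have hfst : (Measure.infinitePi fun _ : ℕ => A.law).real {ω | NoSuccess A n arr jam t ω} =
      (executionLaw A E).real (Prod.fst ⁻¹' {ω | NoSuccess A n arr jam t ω}) := by
    have hmp : MeasurePreserving Prod.fst (executionLaw A E)
        (Measure.infinitePi fun _ : ℕ => A.law) := measurePreserving_fst
    exact (hmp.measureReal_preimage hmeas.nullMeasurableSet).symm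
  rw [hfst]
  have : IsProbabilityMeasure (executionLaw A E) := by unfold executionLaw; infer_instance
  refine measureReal_mono ?_
  rintro ⟨ω, σ⟩ hω
  have hstate := stateAfter_eq_silentState A harr jam ω σ t hω
  have hall : (Finset.range n).filter (fun i => arr i < t) = Finset.range n :=
    Finset.filter_true_of_mem fun i hi => harr_lt i (Finset.mem_range.1 hi)
  -- Without success node 0 never leaves, so at least `t - arr 0` slots are active, which violates
  -- the throughput bound by `hlt`.
  simp only [Set.mem_ofPred_eq, E, hstate, silentState, hall, Finset.card_range, true_and, not_le]
  refine hlt.trans_le ?_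
  have := le_card_active hn arr t
  have h2 : t ≤ ((Finset.range t).filter fun τ => ∃ i < n, arr i ≤ τ).card + arr 0 := by omega
  have h3 : (t : ℝ) ≤ ((Finset.range t).filter fun τ => ∃ i < n, arr i ≤ τ).card + arr 0 := by
    exact_mod_cast h2
  linarith

/-! ### How often a node must broadcast while it hears no success -/

/-- The probability that a node that has heard no success broadcasts at age `a`. -/
noncomputable def silentProb (A : Algorithm.{u}) (a : ℕ) : ℝ :=
  A.law.real {s | A.broadcast s (List.replicate a false) = true}

/-- The ages in `W` at which a node with seed `s` that has heard no success broadcasts. -/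
def broadcastAges (A : Algorithm.{u}) (W : Finset ℕ) (s : A.Seed) : Finset ℕ :=
  W.filter fun a => A.broadcast s (List.replicate a false) = true

/-- There are finitely many possible values, each with a measurable fibre. The σ-algebra `⊤` on the
target makes every property of the set of ages an event. -/
theorem measurable_broadcastAges (A : Algorithm.{u}) (W : Finset ℕ) :
    Measurable[_, ⊤] (broadcastAges A W) := by
  refine @measurable_to_countable' _ _ ⊤ _ _ _ fun B => ?_
  by_cases hB : B ⊆ W
  · have : broadcastAges A W ⁻¹' {B} = ⋂ a ∈ W,
        {s | A.broadcast s (List.replicate a false) = decide (a ∈ B)} := by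
      ext s
      simp only [Set.mem_preimage, Set.mem_singleton_iff, Set.mem_iInter, Set.mem_ofPred_eq,
        broadcastAges, Finset.ext_iff, Finset.mem_filter]
      refine ⟨fun h a ha => ?_, fun h a => ⟨fun ha => ?_, fun ha => ⟨hB ha, ?_⟩⟩⟩
      · have := h a
        by_cases haB : a ∈ B <;> simp_all
      · have := h a ha.1
        simp_all
      · have := h a (hB ha)
        simp_all
    rw [this]
    exact Finset.measurableSet_biInter _ fun a _ =>
      A.measurable_broadcast _ (measurableSet_singleton _)
  · have : broadcastAges A W ⁻¹' {B} = ∅ := by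
      ext s
      simp only [Set.mem_preimage, Set.mem_singleton_iff, Set.mem_empty_iff_false, iff_false]
      rintro rfl
      exact hB (Finset.filter_subset _ _)
    rw [this]
    exact MeasurableSet.empty

theorem measurableSet_broadcastAges (A : Algorithm.{u}) (W : Finset ℕ) (p : Finset ℕ → Prop) :
    MeasurableSet {s | p (broadcastAges A W s)} :=
  measurable_broadcastAges A W (t := {B | p B}) trivial

/-- The number of `m`-element subsets of a set of size at most `R * m` that contain a given
subset of size at most `r ≤ m / 2`. -/
theorem choose_le_card_superset {W B : Finset ℕ} {m r R : ℕ} (hB : B ⊆ W) (hBr : B.card ≤ r)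
    (hr : 2 * r ≤ m) (hR : 1 ≤ R) (hW : W.card ≤ R * m) :
    W.card.choose m ≤
      (2 * R) ^ r * ((Finset.powersetCard m W).filter fun J => B ⊆ J).card := by
  set w := W.card
  set ρ := B.card
  have hcount : (w - ρ).choose (m - ρ) ≤
      ((Finset.powersetCard m W).filter fun J => B ⊆ J).card := by
    rw [← Finset.card_sdiff_of_subset hB, ← Finset.card_powersetCard]
    refine Finset.card_le_card_of_injOn (fun J => J ∪ B) ?_ ?_
    · intro J hJ
      simp only [Finset.mem_coe, Finset.mem_powersetCard] at hJ
      simp only [Finset.mem_coe, Finset.mem_filter, Finset.mem_powersetCard]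
      refine ⟨⟨Finset.union_subset (hJ.1.trans Finset.sdiff_subset) hB, ?_⟩,
        Finset.subset_union_right⟩
      rw [Finset.card_union_of_disjoint
        (Finset.disjoint_of_subset_left hJ.1 Finset.sdiff_disjoint), hJ.2]
      omega
    · intro J hJ K hK h
      simp only [Finset.mem_coe, Finset.mem_powersetCard] at hJ hK
      have hJB := Finset.disjoint_of_subset_left hJ.1 Finset.sdiff_disjoint
      have hKB := Finset.disjoint_of_subset_left hK.1 Finset.sdiff_disjoint
      have := congrArg (· \ B) h
      simpa [Finset.union_sdiff_cancel_right hJB, Finset.union_sdiff_cancel_right hKB] using this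
  refine le_trans ?_ (Nat.mul_le_mul_left _ hcount)
  -- As `ρ ≤ m / 2`, each of the `ρ` factors of `m.descFactorial ρ` is at least `m + 1 - ρ ≥ m / 2`,
  -- hence at least `w / (2 * R)`.
  have hchoose : w.choose ρ ≤ (2 * R) ^ ρ * m.choose ρ := by
    refine Nat.le_of_mul_le_mul_left ?_ ρ.factorial_pos
    calc ρ.factorial * w.choose ρ = w.descFactorial ρ :=
          (Nat.descFactorial_eq_factorial_mul_choose _ _).symm
      _ ≤ w ^ ρ := Nat.descFactorial_le_pow _ _
      _ ≤ (2 * R * (m + 1 - ρ)) ^ ρ := by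
        apply Nat.pow_le_pow_left
        calc w ≤ R * m := hW
          _ ≤ R * (2 * (m + 1 - ρ)) := Nat.mul_le_mul_left _ (by omega)
          _ = _ := by ring
      _ = (2 * R) ^ ρ * (m + 1 - ρ) ^ ρ := mul_pow _ _ _
      _ ≤ (2 * R) ^ ρ * m.descFactorial ρ :=
        Nat.mul_le_mul_left _ (Nat.pow_sub_le_descFactorial _ _)
      _ = _ := by rw [Nat.descFactorial_eq_factorial_mul_choose]; ring
  have hpos : 0 < m.choose ρ := Nat.choose_pos (by omega)
  refine Nat.le_of_mul_le_mul_right ?_ hpos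
  calc w.choose m * m.choose ρ = w.choose ρ * (w - ρ).choose (m - ρ) :=
        Nat.choose_mul (by omega)
    _ ≤ (2 * R) ^ ρ * m.choose ρ * (w - ρ).choose (m - ρ) := Nat.mul_le_mul_right _ hchoose
    _ ≤ (2 * R) ^ r * m.choose ρ * (w - ρ).choose (m - ρ) := by
      gcongr
      omega
    _ = _ := by ring

/-- A node that broadcasts in few slots of a window is blocked by a random set of jammed slots, so
if every such set is unlikely to contain all broadcasts, then few broadcasts are unlikely. -/
theorem measureReal_card_broadcastAges_le (A : Algorithm.{u}) {W : Finset ℕ} {m r R : ℕ}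
    (hr : 2 * r ≤ m) (hR : 1 ≤ R) (hW : W.card ≤ R * m) (hmW : m ≤ W.card) {δ : ℝ}
    (h : ∀ J ∈ Finset.powersetCard m W, A.law.real {s | broadcastAges A W s ⊆ J} ≤ δ) :
    A.law.real {s | (broadcastAges A W s).card ≤ r} ≤ (2 * R) ^ r * δ := by
  obtain ⟨C, hC_def⟩ : ∃ C : ℝ, C = W.card.choose m := ⟨_, rfl⟩
  have hC : 0 < C := hC_def ▸ Nat.cast_pos.2 (Nat.choose_pos hmW)
  have hint : ∀ p : Finset ℕ → Prop, Integrable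
      ({s | p (broadcastAges A W s)}.indicator fun _ => (1 : ℝ)) A.law := fun p =>
    (integrable_const 1).indicator (measurableSet_broadcastAges A W p)
  have hval : ∀ p : Finset ℕ → Prop,
      ∫ s, {s | p (broadcastAges A W s)}.indicator (fun _ => (1 : ℝ)) s ∂A.law =
        A.law.real {s | p (broadcastAges A W s)} := fun p =>
    integral_indicator_one (measurableSet_broadcastAges A W p)
  -- Double counting, integrated over the seed: a seed with at most `r` broadcasts has them all
  -- inside at least `C / (2 * R) ^ r` of the sets `J`.
  have key : C * A.law.real {s | (broadcastAges A W s).card ≤ r} ≤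
      (2 * R) ^ r * ∑ J ∈ Finset.powersetCard m W,
        A.law.real {s | broadcastAges A W s ⊆ J} := by
    rw [← hval fun B => B.card ≤ r, Finset.sum_congr rfl fun J _ => (hval fun B => B ⊆ J).symm,
      ← integral_finsetSum _ fun J _ => hint fun B => B ⊆ J, ← integral_const_mul,
      ← integral_const_mul]
    refine integral_mono ((hint fun B => B.card ≤ r).const_mul _)
      ((integrable_finsetSum _ fun J _ => hint fun B => B ⊆ J).const_mul _) fun s => ?_
    have hsum : ∑ J ∈ Finset.powersetCard m W,
        {s | broadcastAges A W s ⊆ J}.indicator (fun _ => (1 : ℝ)) s =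
        ((Finset.powersetCard m W).filter fun J => broadcastAges A W s ⊆ J).card := by
      rw [Finset.card_filter]
      push_cast
      refine Finset.sum_congr rfl fun J _ => ?_
      simp [Set.indicator_apply]
    simp only [hsum]
    by_cases hs : (broadcastAges A W s).card ≤ r
    · have := choose_le_card_superset (B := broadcastAges A W s) (Finset.filter_subset _ _)
        hs hr hR hW
      rw [Set.indicator_of_mem (by exact hs), mul_one, hC_def]
      exact_mod_cast this
    · rw [Set.indicator_of_notMem (by exact hs), mul_zero]
      positivity
  have hsum : ∑ J ∈ Finset.powersetCard m W, A.law.real {s | broadcastAges A W s ⊆ J} ≤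
      C * δ := by
    refine (Finset.sum_le_card_nsmul _ _ _ h).trans_eq ?_
    rw [Finset.card_powersetCard, nsmul_eq_mul, hC_def]
  refine le_of_mul_le_mul_left (key.trans ?_) hC
  calc _ ≤ (2 * (R : ℝ)) ^ r * (C * δ) := by gcongr
    _ = _ := by ring

/-- The sum is the expected number of broadcasts in `W`, and with probability at least `1 / 2` that
number exceeds `r`. -/
theorem sum_silentProb_ge (A : Algorithm.{u}) {W : Finset ℕ} {r : ℕ}
    (h : A.law.real {s | (broadcastAges A W s).card ≤ r} ≤ 1 / 2) :
    (r : ℝ) / 2 ≤ ∑ a ∈ W, silentProb A a := by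
  have hms : MeasurableSet {s | (broadcastAges A W s).card ≤ r} :=
    measurableSet_broadcastAges A W fun B => B.card ≤ r
  have hcompl : 1 / 2 ≤ A.law.real {s | (broadcastAges A W s).card ≤ r}ᶜ := by
    rw [probReal_compl_eq_one_sub hms]
    linarith
  have hsum : ∑ a ∈ W, silentProb A a =
      ∫ s, ∑ a ∈ W, {s | A.broadcast s (List.replicate a false) = true}.indicator
        (fun _ => (1 : ℝ)) s ∂A.law := by
    rw [integral_finsetSum _ fun a _ =>
      (integrable_const 1).indicator (measurableSet_broadcast A _)]
    exact Finset.sum_congr rfl fun a _ =>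
      (integral_indicator_one (measurableSet_broadcast A _)).symm
  have hlow : (r : ℝ) * A.law.real {s | (broadcastAges A W s).card ≤ r}ᶜ =
      ∫ s, {s | (broadcastAges A W s).card ≤ r}ᶜ.indicator (fun _ => (r : ℝ)) s ∂A.law := by
    rw [integral_indicator_const _ hms.compl, smul_eq_mul, mul_comm]
  calc (r : ℝ) / 2 = r * (1 / 2) := by ring
    _ ≤ r * A.law.real {s | (broadcastAges A W s).card ≤ r}ᶜ := by gcongr
    _ ≤ _ := by
      rw [hlow, hsum]
      refine integral_mono ((integrable_const _).indicator hms.compl)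
        (integrable_finsetSum _ fun a _ =>
          (integrable_const 1).indicator (measurableSet_broadcast A _)) fun s => ?_
      have : ∑ a ∈ W, {s | A.broadcast s (List.replicate a false) = true}.indicator
          (fun _ => (1 : ℝ)) s = (broadcastAges A W s).card := by
        rw [broadcastAges, Finset.card_filter]
        push_cast
        exact Finset.sum_congr rfl fun a _ => by simp [Set.indicator_apply]
      simp only [this]
      refine Set.indicator_apply_le' (fun hs => ?_) fun _ => by positivity
      simp only [Set.mem_compl_iff, Set.mem_ofPred_eq, not_le] at hs
      exact_mod_cast hs.le

/-- In a window of ages `[m, R m)`, a node that has heard no success broadcasts often: otherwise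
jamming the first `m` slots and `m` slots of the window blocks it with significant probability. -/
theorem AchievesThroughput.sum_silentProb_window_ge {A : Algorithm.{u}} {f g : ℝ → ℝ}
    (hA : AchievesThroughput A f g) {m r R n : ℕ} (hm : 1 ≤ m) (hr : 2 * r ≤ m) (hR : 3 ≤ R)
    (hn : 2 * (2 * R) ^ r ≤ n) (hg : 0 ≤ g (R * m : ℕ))
    (hlt : n * f (R * m : ℕ) + (2 * m + 1) * g (R * m : ℕ) < (R * m : ℕ)) :
    (r : ℝ) / 2 ≤ ∑ a ∈ Finset.Ico m (R * m), silentProb A a := by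
  have hRm : 3 * m ≤ R * m := Nat.mul_le_mul_right _ hR
  set M := R * m with hM
  -- The last slot `M - 1` is kept for the arrival of the other nodes.
  set W := Finset.Ico m (M - 1)
  have hWcard : W.card = M - 1 - m := Nat.card_Ico _ _
  have hpow : 0 < (2 * R) ^ r := by positivity
  have hn1 : 1 ≤ n := by omega
  have hblock : ∀ J ∈ Finset.powersetCard m W,
      A.law.real {s | broadcastAges A W s ⊆ J} ≤ 1 / n := by
    intro J hJ
    rw [Finset.mem_powersetCard] at hJ
    -- Node 0 is alone until the last slot. The other `n - 1` nodes arrive in that jammed slot and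
    -- only serve to lower the permitted failure probability to `1 / n`.
    set arr : ℕ → ℕ := fun i => if i = 0 then 0 else M - 1 with harr_def
    have harr : Monotone arr := by
      intro i j hij
      simp only [harr_def]
      split_ifs <;> omega
    set jam : ℕ → Bool := fun τ => decide (τ < m ∨ τ ∈ J ∨ τ = M - 1) with hjam
    have hjam_card : ((Finset.range M).filter fun τ => jam τ = true).card ≤ 2 * m + 1 := by
      calc _ ≤ (Finset.range m ∪ (J ∪ {M - 1})).card := by
            apply Finset.card_le_card
            intro τ hτ
            simp only [hjam, Finset.mem_filter, decide_eq_true_eq] at hτ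
            simp only [Finset.mem_union, Finset.mem_range, Finset.mem_singleton]
            exact hτ.2
        _ ≤ m + (m + 1) := by
            refine (Finset.card_union_le _ _).trans (add_le_add (by simp) ?_)
            refine (Finset.card_union_le _ _).trans (add_le_add hJ.2.le (by simp))
        _ = _ := by ring
    have hmain := hA.measureReal_noSuccess_le (t := M) hn1 harr
      (fun i _ => by simp only [harr_def]; split_ifs <;> omega) jam (by
        refine lt_of_le_of_lt ?_ (hlt.trans_eq (by simp [harr_def]))
        gcongr
        exact_mod_cast hjam_card)
    refine le_trans ?_ hmain
    have hmp := measurePreserving_eval_infinitePi (fun _ : ℕ => A.law) 0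
    rw [← hmp.measureReal_preimage
      (measurableSet_broadcastAges A W fun B => B ⊆ J).nullMeasurableSet]
    -- If all broadcasts of node 0 in `W` fall in `J`, every unjammed slot is silent.
    refine measureReal_mono fun ω hω => ?_
    simp only [Set.mem_preimage, Function.eval, Set.mem_ofPred_eq] at hω
    intro τ hτ
    rw [or_iff_not_imp_left]
    intro hτjam
    simp only [hjam, decide_eq_true_eq, not_or, not_lt] at hτjam
    have : silentBroadcasters A n arr ω τ = ∅ := by
      refine Finset.filter_eq_empty_iff.2 fun i _ => ?_
      rintro ⟨h1, h2⟩
      by_cases hi : i = 0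
      · subst hi
        refine hτjam.2.1 (hω ?_)
        simp only [harr_def, if_true, Nat.sub_zero] at h2
        exact Finset.mem_filter.2 ⟨Finset.mem_Ico.2 ⟨hτjam.1, by omega⟩, h2⟩
      · simp only [harr_def, hi, if_false] at h1
        omega
    simp [this]
  have hfew := measureReal_card_broadcastAges_le A hr (by omega : 1 ≤ R) (by omega) (by omega)
    hblock
  have hn2 : (0 : ℝ) < n := by exact_mod_cast hn1
  have hhalf : A.law.real {s | (broadcastAges A W s).card ≤ r} ≤ 1 / 2 := by
    refine hfew.trans ?_
    rw [mul_one_div, div_le_div_iff₀ hn2 two_pos]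
    have : (2 * (2 * R) ^ r : ℝ) ≤ n := by exact_mod_cast hn
    linarith
  refine (sum_silentProb_ge A hhalf).trans ?_
  refine Finset.sum_le_sum_of_subset_of_nonneg (Finset.Ico_subset_Ico_right (by omega)) ?_
  intro a _ _
  exact measureReal_nonneg

/-- Summing over the windows `[R ^ j, R ^ (j + 1))` with `4 r ≤ j < 8 r`. -/
theorem AchievesThroughput.sum_silentProb_ge {A : Algorithm.{u}} {f g : ℝ → ℝ}
    (hA : AchievesThroughput A f g) {r R b : ℕ} (hR : 16 ≤ R) (hb : b ≤ R ^ (2 * r))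
    (hg0 : ∀ M : ℕ, 1 ≤ M → 0 ≤ g M)
    (hf : ∀ M : ℕ, 1 ≤ M → M ≤ R ^ (8 * r) → f M ≤ b / 4)
    (hg : ∀ M : ℕ, 1 ≤ M → M ≤ R ^ (8 * r) → g M ≤ R / 16) :
    2 * (r : ℝ) ^ 2 ≤ ∑ a ∈ Finset.Ico (R ^ (4 * r)) (R ^ (8 * r)), silentProb A a := by
  have hR0 : 0 < R := by omega
  have hwin : ∀ j, 4 * r ≤ j → j < 8 * r →
      (r : ℝ) / 2 ≤ ∑ a ∈ Finset.Ico (R ^ j) (R ^ (j + 1)), silentProb A a := by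
    intro j hj hj8
    have hm1 : 1 ≤ R ^ j := Nat.one_le_pow _ _ hR0
    have hM : R * R ^ j = R ^ (j + 1) := (pow_succ' R j).symm
    have hM1 : 1 ≤ R * R ^ j := by rw [hM]; exact Nat.one_le_pow _ _ hR0
    have hMle : R * R ^ j ≤ R ^ (8 * r) := by
      rw [hM]; exact Nat.pow_le_pow_right hR0 (by omega)
    have h2r : 2 * r ≤ R ^ j := by
      have := Nat.lt_pow_self (n := j) (show 1 < R by omega)
      omega
    have hn : 2 * (2 * R) ^ r ≤ 2 * R ^ (2 * r) := by
      rw [pow_mul]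
      gcongr
      nlinarith
    -- This `n` is large enough because `2 * R ≤ R ^ 2`. It is small enough because `j ≥ 4 * r`
    -- gives `n * f M ≤ R ^ (4 * r) / 2 ≤ M / 2`; jamming adds at most `3 * M / 16`.
    have := hA.sum_silentProb_window_ge (m := R ^ j) (n := 2 * R ^ (2 * r)) hm1 h2r
      (by omega) hn (hg0 _ hM1) (by
        have h1 := hf _ hM1 hMle
        have h2 := hg _ hM1 hMle
        have h3 := hg0 _ hM1
        set M : ℕ := R * R ^ j with hMdef
        have hmR : (1 : ℝ) ≤ (R ^ j : ℕ) := by exact_mod_cast hm1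
        have hMR : (M : ℝ) = R * (R ^ j : ℕ) := by rw [hMdef]; push_cast; ring
        have hbR : (b : ℝ) ≤ (R ^ (2 * r) : ℕ) := by exact_mod_cast hb
        have h4 : (R ^ (2 * r) : ℕ) * (R ^ (2 * r) : ℕ) ≤ M := by
          rw [hM, ← pow_add]
          exact Nat.pow_le_pow_right hR0 (by omega)
        have h4' : ((R ^ (2 * r) : ℕ) : ℝ) * (R ^ (2 * r) : ℕ) ≤ M := by exact_mod_cast h4
        have h5 : ((2 * R ^ (2 * r) : ℕ) : ℝ) * f M ≤ M / 2 := by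
          calc ((2 * R ^ (2 * r) : ℕ) : ℝ) * f M ≤ (2 * R ^ (2 * r) : ℕ) * (b / 4) := by gcongr
            _ = (R ^ (2 * r) : ℕ) * b / 2 := by push_cast; ring
            _ ≤ (R ^ (2 * r) : ℕ) * (R ^ (2 * r) : ℕ) / 2 := by gcongr
            _ ≤ M / 2 := by gcongr
        have h6 : (2 * ((R ^ j : ℕ) : ℝ) + 1) * g M ≤ 3 * M / 16 := by
          calc (2 * ((R ^ j : ℕ) : ℝ) + 1) * g M ≤ (3 * (R ^ j : ℕ)) * (R / 16) := by
                gcongr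
                linarith
            _ = 3 * M / 16 := by rw [hMR]; ring
        have h7 : (0 : ℝ) < M := by exact_mod_cast hM1
        linarith)
    rwa [hM] at this
  have hsum : ∀ k, k ≤ 4 * r → k * ((r : ℝ) / 2) ≤
      ∑ a ∈ Finset.Ico (R ^ (4 * r)) (R ^ (4 * r + k)), silentProb A a := by
    intro k
    induction k with
    | zero => simp
    | succ k ih =>
      intro hk
      rw [← Finset.sum_Ico_consecutive _ (Nat.pow_le_pow_right hR0 (by omega : 4 * r ≤ 4 * r + k))
        (Nat.pow_le_pow_right hR0 (by omega : 4 * r + k ≤ 4 * r + (k + 1)))]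
      have h1 := ih (by omega)
      have h2 := hwin (4 * r + k) (by omega) (by omega)
      rw [← add_assoc]
      push_cast
      linarith
  have := hsum (4 * r) le_rfl
  rw [show 4 * r + 4 * r = 8 * r by ring] at this
  refine le_trans (le_of_eq ?_) this
  push_cast
  ring

/-! ### Contention when one node arrives in each block -/

/-- The probability that a node that arrives in slot `x` broadcasts in slot `τ`, if no slot before
`τ` is successful. -/
noncomputable def silentProbAt (A : Algorithm.{u}) (τ x : ℕ) : ℝ :=
  if x ≤ τ then silentProb A (τ - x) else 0

theorem silentProb_nonneg (A : Algorithm.{u}) (a : ℕ) : 0 ≤ silentProb A a := measureReal_nonneg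

theorem silentProb_le_one (A : Algorithm.{u}) (a : ℕ) : silentProb A a ≤ 1 := measureReal_le_one

theorem silentProbAt_nonneg (A : Algorithm.{u}) (τ x : ℕ) : 0 ≤ silentProbAt A τ x := by
  unfold silentProbAt
  split_ifs
  exacts [silentProb_nonneg A _, le_rfl]

theorem silentProbAt_le_one (A : Algorithm.{u}) (τ x : ℕ) : silentProbAt A τ x ≤ 1 := by
  unfold silentProbAt
  split_ifs
  exacts [silentProb_le_one A _, zero_le_one]

/-- Markov's inequality for `2 ^ (- X)`, where `X` is the number of broadcasters. -/
theorem measureReal_card_silentBroadcasters_eq_one_le (A : Algorithm.{u}) (n : ℕ) (arr : ℕ → ℕ)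
    (τ : ℕ) :
    (Measure.infinitePi fun _ : ℕ => A.law).real {ω | (silentBroadcasters A n arr ω τ).card = 1} ≤
      2 * ∏ i ∈ Finset.range n, (1 - silentProbAt A τ (arr i) / 2) := by
  set S : ℕ → Set A.Seed := fun i =>
    {s | arr i ≤ τ ∧ A.broadcast s (List.replicate (τ - arr i) false) = true} with hS_def
  have hS : ∀ i, MeasurableSet (S i) := fun i =>
    (MeasurableSet.const _).inter (measurableSet_broadcast A _)
  have hSprob : ∀ i, A.law.real (S i) = silentProbAt A τ (arr i) := by
    intro i
    by_cases h : arr i ≤ τ <;> simp [hS_def, silentProbAt, silentProb, h]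
  -- The factor is `1 / 2` if node `i` broadcasts and `1` otherwise, so the product is `2 ^ (-X)`,
  -- and independence factorises its expectation.
  set h : ℕ → A.Seed → ℝ := fun i s => 1 - (S i).indicator (fun _ => (1 : ℝ)) s / 2 with hh
  have hmeas : ∀ i, Measurable (h i) := fun i =>
    measurable_const.sub ((measurable_const.indicator (hS i)).div_const 2)
  have hint : ∀ i, ∫ s, h i s ∂A.law = 1 - silentProbAt A τ (arr i) / 2 := by
    intro i
    have hi : Integrable ((S i).indicator fun _ => (1 : ℝ)) A.law :=
      (integrable_const 1).indicator (hS i)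
    have hval : ∫ s, (S i).indicator (fun _ => (1 : ℝ)) s ∂A.law = A.law.real (S i) :=
      integral_indicator_one (hS i)
    simp only [hh]
    rw [integral_sub (integrable_const _) (hi.div_const 2), integral_div, hval, hSprob]
    simp
  have hprod : ∫ ω, ∏ i ∈ Finset.range n, h i (ω i) ∂(Measure.infinitePi fun _ : ℕ => A.law) =
      ∏ i ∈ Finset.range n, (1 - silentProbAt A τ (arr i) / 2) := by
    have hrestrict : ∀ ω : ℕ → A.Seed, ∏ i ∈ Finset.range n, h i (ω i) =
        (fun y : (i : Finset.range n) → A.Seed => ∏ i : Finset.range n, h i (y i))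
          ((Finset.range n).restrict ω) := fun ω =>
      (Finset.prod_coe_sort (Finset.range n) fun i => h i (ω i)).symm
    simp_rw [hrestrict]
    refine (integral_restrict_infinitePi (μ := fun _ : ℕ => A.law) (s := Finset.range n)
      (f := fun y => ∏ i : Finset.range n, h i (y i)) ?_).trans ?_
    · refine Measurable.aestronglyMeasurable ?_
      exact Finset.measurable_prod _ fun i _ => (hmeas i).comp (measurable_pi_apply i)
    · rw [integral_fintype_prod_eq_prod (fun (i : Finset.range n) s => h i s)]
      simp_rw [hint]
      exact Finset.prod_coe_sort (Finset.range n) fun i => 1 - silentProbAt A τ (arr i) / 2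
  have hpow : ∀ ω : ℕ → A.Seed, ∏ i ∈ Finset.range n, h i (ω i) =
      (1 / 2 : ℝ) ^ (silentBroadcasters A n arr ω τ).card := by
    intro ω
    rw [silentBroadcasters, ← Finset.prod_const, Finset.prod_filter]
    refine Finset.prod_congr rfl fun i _ => ?_
    simp only [hh, hS_def, Set.indicator_apply, Set.mem_ofPred_eq]
    split_ifs <;> norm_num
  have hmeasprod : Measurable fun ω : ℕ → A.Seed => ∏ i ∈ Finset.range n, h i (ω i) :=
    Finset.measurable_prod _ fun i _ => (hmeas i).comp (measurable_pi_apply i)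
  have hmarkov := mul_meas_ge_le_integral_of_nonneg
    (μ := Measure.infinitePi fun _ : ℕ => A.law)
    (f := fun ω => ∏ i ∈ Finset.range n, h i (ω i))
    (ae_of_all _ fun ω => by simp only [hpow]; positivity)
    (Integrable.of_bound hmeasprod.aestronglyMeasurable 1 (ae_of_all _ fun ω => by
      rw [hpow, Real.norm_of_nonneg (by positivity)]
      exact pow_le_one₀ (by norm_num) (by norm_num))) (1 / 2)
  rw [hprod] at hmarkov
  have hsub : (Measure.infinitePi fun _ : ℕ => A.law).real
      {ω | (silentBroadcasters A n arr ω τ).card = 1} ≤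
      (Measure.infinitePi fun _ : ℕ => A.law).real
        {ω | 1 / 2 ≤ ∏ i ∈ Finset.range n, h i (ω i)} := by
    refine measureReal_mono fun ω hω => ?_
    simp only [Set.mem_ofPred_eq] at hω ⊢
    rw [hpow, hω]
    norm_num
  linarith

/-- The arrival times when node `i` arrives in the `i`-th block of `b` slots, with offset `s i`. -/
def blockArrival (n b : ℕ) (s : Fin n → ℕ) (i : ℕ) : ℕ :=
  i * b + if h : i < n then s ⟨i, h⟩ else 0

theorem blockArrival_monotone {n b : ℕ} {s : Fin n → ℕ} (hs : ∀ i, s i < b) :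
    Monotone (blockArrival n b s) := by
  refine monotone_nat_of_le_succ fun i => ?_
  unfold blockArrival
  rw [add_mul, one_mul]
  have : (if h : i < n then s ⟨i, h⟩ else 0) ≤ b := by
    split_ifs with h
    · exact (hs _).le
    · exact Nat.zero_le _
  omega

/-- At a fixed slot `τ`, the arrival slot `x = τ - a` corresponds to age `a`; since `l ≤ τ`, every
age in the interval comes from some arrival slot. -/
theorem sum_silentProbAt_range (A : Algorithm.{u}) {τ T k l : ℕ} (hτ : τ < T) (hl : l ≤ τ) :
    ∑ a ∈ Finset.Ico k l, silentProb A a ≤ ∑ x ∈ Finset.range T, silentProbAt A τ x := by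
  calc ∑ a ∈ Finset.Ico k l, silentProb A a ≤ ∑ a ∈ Finset.range (τ + 1), silentProb A a := by
        refine Finset.sum_le_sum_of_subset_of_nonneg ?_ fun a _ _ => silentProb_nonneg A a
        intro a ha
        simp only [Finset.mem_Ico, Finset.mem_range] at ha ⊢
        omega
    _ = ∑ x ∈ Finset.range (τ + 1), silentProbAt A τ x := by
        rw [← Finset.sum_range_reflect]
        refine Finset.sum_congr rfl fun x hx => ?_
        rw [Finset.mem_range] at hx
        rw [silentProbAt, if_pos (by omega)]
        congr 1
    _ ≤ _ := by
        refine Finset.sum_le_sum_of_subset_of_nonneg ?_ fun x _ _ => silentProbAt_nonneg A τ x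
        exact Finset.range_subset_range.2 hτ

theorem sum_range_mul_block (f : ℕ → ℝ) (n b : ℕ) :
    ∑ x ∈ Finset.range (n * b), f x =
      ∑ i ∈ Finset.range n, ∑ s ∈ Finset.range b, f (i * b + s) := by
  induction n with
  | zero => simp
  | succ n ih => rw [add_mul, one_mul, Finset.sum_range_add, ih, Finset.sum_range_succ]

/-- If nodes arrive at uniformly random slots of the blocks, then success in slot `τ` is
exponentially unlikely in the contention. -/
theorem sum_measureReal_success_le (A : Algorithm.{u}) {n b τ : ℕ} (hb : 1 ≤ b) {μ : ℝ}
    (hμ : μ ≤ ∑ x ∈ Finset.range (n * b), silentProbAt A τ x) :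
    ∑ s ∈ Fintype.piFinset fun _ : Fin n => Finset.range b,
      (Measure.infinitePi fun _ : ℕ => A.law).real
        {ω | (silentBroadcasters A n (blockArrival n b s) ω τ).card = 1} ≤
      2 * ((b : ℝ) ^ n * Real.exp (-(μ / (2 * b)))) := by
  have hb0 : (0 : ℝ) < b := by exact_mod_cast hb
  calc _ ≤ ∑ s ∈ Fintype.piFinset fun _ : Fin n => Finset.range b,
        2 * ∏ i : Fin n, (1 - silentProbAt A τ (i * b + s i) / 2) := by
        refine Finset.sum_le_sum fun s _ => ?_
        refine (measureReal_card_silentBroadcasters_eq_one_le A n _ τ).trans_eq ?_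
        rw [Finset.prod_range]
        congr 1
        refine Finset.prod_congr rfl fun i _ => ?_
        simp [blockArrival]
    -- The offsets vary independently, so the sum over all of them factorises over the blocks.
    _ = 2 * ∏ i : Fin n, ∑ s ∈ Finset.range b, (1 - silentProbAt A τ (i * b + s) / 2) := by
        rw [← Finset.mul_sum, Finset.prod_univ_sum]
    _ ≤ 2 * ∏ i : Fin n,
          ((b : ℝ) * Real.exp (-((∑ s ∈ Finset.range b, silentProbAt A τ (i * b + s)) /
            (2 * b)))) := by
        refine mul_le_mul_of_nonneg_left
          (Finset.prod_le_prod (fun i _ => ?_) fun i _ => ?_) zero_le_two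
        · refine Finset.sum_nonneg fun s _ => ?_
          linarith [silentProbAt_le_one A τ (i * b + s)]
        · rw [Finset.sum_sub_distrib, ← Finset.sum_div]
          simp only [Finset.sum_const, Finset.card_range, nsmul_eq_mul, mul_one]
          set Q := ∑ s ∈ Finset.range b, silentProbAt A τ (i * b + s)
          calc (b : ℝ) - Q / 2 = b * (-(Q / (2 * b)) + 1) := by field_simp; ring
            _ ≤ _ := by gcongr; exact Real.add_one_le_exp _
    _ ≤ _ := by
        rw [Finset.prod_mul_distrib, ← Real.exp_sum, Finset.prod_const, Finset.card_univ,
          Fintype.card_fin, Finset.sum_neg_distrib, ← Finset.sum_div]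
        gcongr
        rw [sum_range_mul_block, Finset.sum_range] at hμ
        exact hμ

/-! ### The contradiction and the choice of parameters -/

/-- A quantitative form of the impossibility: the throughput bounds `f ≤ b / 4` and `g ≤ R / 16`
cannot hold up to time `R ^ (8 * r + 1) * b` if `r ^ 2 / b` exceeds the logarithm of that time. -/
theorem not_achievesThroughput_of_bounds {A : Algorithm.{u}} {f g : ℝ → ℝ} {r R b : ℕ}
    (hR : 16 ≤ R) (hb : 1 ≤ b) (hbR : b ≤ R ^ (2 * r))
    (hg0 : ∀ M : ℕ, 1 ≤ M → 0 ≤ g M)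
    (hf : ∀ M : ℕ, 1 ≤ M → M ≤ R ^ (8 * r + 1) * b → f M ≤ b / 4)
    (hg : ∀ M : ℕ, 1 ≤ M → M ≤ R ^ (8 * r + 1) * b → g M ≤ R / 16)
    (hexp : 4 * ((R ^ (8 * r + 1) * b : ℕ) : ℝ) < Real.exp ((r : ℝ) ^ 2 / b)) :
    ¬ AchievesThroughput A f g := by
  intro hA
  have hR0 : 0 < R := by omega
  set m := R ^ (8 * r) with hm
  have hm1 : 1 ≤ m := Nat.one_le_pow _ _ hR0
  set n := R ^ (8 * r + 1) with hn
  have hnm : n = m * R := by rw [hn, pow_succ]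
  have hmn : m * 16 ≤ n := hnm ▸ Nat.mul_le_mul_left _ hR
  have hbm : b ≤ m := hbR.trans (Nat.pow_le_pow_right hR0 (by omega))
  set T := n * b with hT
  have hnT : n ≤ T := Nat.le_mul_of_pos_right _ hb
  have hb0 : (0 : ℝ) < b := by exact_mod_cast hb
  have hS := hA.sum_silentProb_ge hR hbR hg0 (fun M h1 h2 => hf M h1 (by omega))
    fun M h1 h2 => hg M h1 (by omega)
  -- For each fixed choice of offsets, throughput forces a success with probability at least `1 /
  -- 2`. With the first `m` slots jammed, the bound is at most `T / 4 + T / 16`, while the first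
  -- arrival costs at most `b ≤ m ≤ T / 16`.
  have hsucc : ∀ s ∈ Fintype.piFinset fun _ : Fin n => Finset.range b,
      1 / 2 ≤ ∑ τ ∈ Finset.Ico m T, (Measure.infinitePi fun _ : ℕ => A.law).real
        {ω | (silentBroadcasters A n (blockArrival n b s) ω τ).card = 1} := by
    intro s hs
    have hs' : ∀ i, s i < b := fun i => Finset.mem_range.1 (Fintype.mem_piFinset.1 hs i)
    have hno := hA.measureReal_noSuccess_le (n := n) (t := T) (by omega) (blockArrival_monotone hs')
      (fun i hi => by
        have h1 := hs' ⟨i, hi⟩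
        have h2 : (i + 1) * b ≤ n * b := Nat.mul_le_mul_right _ hi
        rw [add_mul] at h2
        simp only [blockArrival, hi, dif_pos]
        omega) (fun τ => decide (τ < m)) (by
        have h1 := hf T (by omega) le_rfl
        have h2 := hg T (by omega) le_rfl
        have h3 := hg0 T (by omega)
        have h4 : ((Finset.range T).filter fun τ => decide (τ < m) = true).card ≤ m := by
          calc _ ≤ (Finset.range m).card := by
                apply Finset.card_le_card
                intro τ hτ
                simpa using (Finset.mem_filter.1 hτ).2
            _ = m := Finset.card_range m
        have h5 : blockArrival n b s 0 ≤ b := by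
          have := hs' ⟨0, by omega⟩
          simp only [blockArrival, show 0 < n by omega, dif_pos]
          omega
        have h4' : (((Finset.range T).filter fun τ => decide (τ < m) = true).card : ℝ) ≤ m := by
          exact_mod_cast h4
        have h5' : (blockArrival n b s 0 : ℝ) ≤ m := by exact_mod_cast h5.trans hbm
        have h6 : (n : ℝ) * f T ≤ T / 4 := by
          calc (n : ℝ) * f T ≤ n * (b / 4) := by gcongr
            _ = T / 4 := by rw [hT]; push_cast; ring
        have h7 : (((Finset.range T).filter fun τ => decide (τ < m) = true).card : ℝ) * g T ≤
            T / 16 := by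
          calc _ ≤ (m : ℝ) * (R / 16) := by gcongr
            _ = (n : ℝ) / 16 := by rw [hnm]; push_cast; ring
            _ ≤ T / 16 := by gcongr
        have h8 : (m : ℝ) * 16 ≤ T := by exact_mod_cast hmn.trans hnT
        have h9 : (1 : ℝ) ≤ m := by exact_mod_cast hm1
        linarith)
    have hcover : (Set.univ : Set (ℕ → A.Seed)) ⊆
        {ω | NoSuccess A n (blockArrival n b s) (fun τ => decide (τ < m)) T ω} ∪
          ⋃ τ ∈ Finset.Ico m T,
            {ω | (silentBroadcasters A n (blockArrival n b s) ω τ).card = 1} := by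
      intro ω _
      by_cases hω : NoSuccess A n (blockArrival n b s) (fun τ => decide (τ < m)) T ω
      · exact Or.inl hω
      · right
        simp only [NoSuccess, not_forall, not_or, decide_eq_true_eq, not_lt, not_not] at hω
        obtain ⟨τ, h1, h2, h3⟩ := hω
        simp only [Set.mem_iUnion]
        exact ⟨τ, Finset.mem_Ico.2 ⟨h2, h1⟩, h3⟩
    have h1 := measureReal_mono (μ := Measure.infinitePi fun _ : ℕ => A.law) hcover
    rw [probReal_univ] at h1
    have h2 := h1.trans ((measureReal_union_le _ _).trans
      (add_le_add hno (measureReal_biUnion_finset_le _ _)))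
    have h3 : (1 : ℝ) / n ≤ 1 / 2 := by
      apply one_div_le_one_div_of_le two_pos
      exact_mod_cast (by omega : 2 ≤ n)
    linarith
  have hcard : ((Fintype.piFinset fun _ : Fin n => Finset.range b).card : ℝ) = (b : ℝ) ^ n := by
    simp
  have hlow := Finset.card_nsmul_le_sum _ _ _ hsucc
  rw [nsmul_eq_mul, hcard, Finset.sum_comm] at hlow
  -- Past the jammed prefix, `τ ≥ m = R ^ (8 * r)`, so all ages counted in `hS` contribute to the
  -- contention in slot `τ`.
  have hup : ∀ τ ∈ Finset.Ico m T, ∑ s ∈ Fintype.piFinset fun _ : Fin n => Finset.range b,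
      (Measure.infinitePi fun _ : ℕ => A.law).real
        {ω | (silentBroadcasters A n (blockArrival n b s) ω τ).card = 1} ≤
      2 * ((b : ℝ) ^ n * Real.exp (-((r : ℝ) ^ 2 / b))) := by
    intro τ hτ
    rw [Finset.mem_Ico] at hτ
    refine (sum_measureReal_success_le A hb
      (hS.trans (sum_silentProbAt_range A hτ.2 hτ.1))).trans_eq ?_
    rw [mul_div_mul_left _ _ two_ne_zero]
  have hbn : (0 : ℝ) < (b : ℝ) ^ n := by positivity
  have htot := hlow.trans (Finset.sum_le_card_nsmul _ _ _ hup)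
  rw [nsmul_eq_mul, Nat.card_Ico, Real.exp_neg] at htot
  have hTm : ((T - m : ℕ) : ℝ) ≤ T := by exact_mod_cast Nat.sub_le _ _
  have hE := Real.exp_pos ((r : ℝ) ^ 2 / b)
  have hlt : (T : ℝ) * (2 * ((b : ℝ) ^ n * (Real.exp ((r : ℝ) ^ 2 / b))⁻¹)) <
      (b : ℝ) ^ n * (1 / 2) := by
    have : (T : ℝ) * (Real.exp ((r : ℝ) ^ 2 / b))⁻¹ < 1 / 4 := by
      rw [← div_eq_mul_inv, div_lt_iff₀ hE]
      linarith
    nlinarith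
  have hle : ((T - m : ℕ) : ℝ) * (2 * ((b : ℝ) ^ n * (Real.exp ((r : ℝ) ^ 2 / b))⁻¹)) ≤
      T * (2 * ((b : ℝ) ^ n * (Real.exp ((r : ℝ) ^ 2 / b))⁻¹)) := by gcongr
  linarith

/-- The parameters needed in `not_achievesThroughput_of_bounds`. -/
theorem exists_block_parameters {R b : ℕ} {x : ℝ} (hR : 16 ≤ R) (hb : 1 ≤ b)
    (hx : 2048 * (b : ℝ) * Real.log R ^ 2 < x) :
    ∃ r : ℕ, b ≤ R ^ (2 * r) ∧ ((R ^ (8 * r + 1) * b : ℕ) : ℝ) ≤ Real.exp x ∧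
      4 * ((R ^ (8 * r + 1) * b : ℕ) : ℝ) < Real.exp ((r : ℝ) ^ 2 / b) := by
  set l := Real.log R with hl
  have hR0 : (0 : ℝ) < R := by exact_mod_cast (by omega : 0 < R)
  have hb1 : (1 : ℝ) ≤ b := by exact_mod_cast hb
  have hRexp : (R : ℝ) = Real.exp l := (Real.exp_log hR0).symm
  have hl1 : 2 ≤ l := by
    rw [hl, Real.le_log_iff_exp_le hR0]
    have h1 : Real.exp 2 = Real.exp 1 * Real.exp 1 := by rw [← Real.exp_add]; norm_num
    have h2 := Real.exp_one_lt_d9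
    have h3 := Real.exp_pos 1
    have h4 : (16 : ℝ) ≤ R := by exact_mod_cast hR
    nlinarith
  have hl0 : 0 < l := by linarith
  have hl2 : 2 * l ≤ l ^ 2 := by nlinarith
  have hbl : l ^ 2 ≤ b * l ^ 2 := le_mul_of_one_le_left (by positivity) hb1
  have hbl' : (b : ℝ) * 4 ≤ b * l ^ 2 := by gcongr; nlinarith
  have hx0 : 0 < x := by nlinarith
  -- Then `8 * r * l ≤ x / 2` leaves room in the exponent for the extra factors `R` and `b`, while
  -- `r ≥ x / (32 * l)` gives `r ^ 2 ≥ x ^ 2 / (1024 * l ^ 2) > 2 * x * b`.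
  obtain ⟨r, hr⟩ : ∃ r : ℕ, r = ⌊x / (16 * l)⌋₊ := ⟨_, rfl⟩
  have hr1 : (r : ℝ) * (16 * l) ≤ x := by
    rw [← le_div_iff₀ (by positivity), hr]
    exact Nat.floor_le (by positivity)
  have hr2 : x < ((r : ℝ) + 1) * (16 * l) := by
    rw [← div_lt_iff₀ (by positivity), hr]
    exact Nat.lt_floor_add_one _
  have hr3 : x ≤ r * (32 * l) := by nlinarith
  have hbexp : (b : ℝ) ≤ Real.exp (b - 1) := by
    have := Real.add_one_le_exp ((b : ℝ) - 1)
    linarith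
  have hpow : ∀ k : ℕ, (R : ℝ) ^ k = Real.exp (k * l) := fun k => by
    rw [Real.exp_nat_mul, hRexp]
  have hT : ((R ^ (8 * r + 1) * b : ℕ) : ℝ) ≤ Real.exp x := by
    push_cast
    rw [hpow]
    refine (mul_le_mul_of_nonneg_left hbexp (Real.exp_pos _).le).trans ?_
    rw [← Real.exp_add, Real.exp_le_exp]
    push_cast
    nlinarith
  refine ⟨r, ?_, hT, ?_⟩
  · have : (b : ℝ) ≤ (R : ℝ) ^ (2 * r) := by
      rw [hpow]
      refine hbexp.trans (Real.exp_le_exp.2 ?_)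
      push_cast
      nlinarith
    exact_mod_cast this
  · have h4 : (4 : ℝ) ≤ Real.exp x := by
      have := Real.add_one_le_exp x
      nlinarith
    have hsq : 2 * x < (r : ℝ) ^ 2 / b := by
      rw [lt_div_iff₀ (by linarith)]
      have h5 : x * x ≤ (r * (32 * l)) * (r * (32 * l)) :=
        mul_le_mul hr3 hr3 hx0.le (by positivity)
      have h6 : x * (2048 * (b : ℝ) * l ^ 2) < x * x := mul_lt_mul_of_pos_left hx hx0
      have h7 : (2 * x * b) * (1024 * l ^ 2) < (r : ℝ) ^ 2 * (1024 * l ^ 2) := by nlinarith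
      exact lt_of_mul_lt_mul_right h7 (by positivity)
    calc 4 * ((R ^ (8 * r + 1) * b : ℕ) : ℝ) ≤ Real.exp x * Real.exp x := by gcongr
      _ = Real.exp (2 * x) := by rw [← Real.exp_add]; ring_nf
      _ < _ := Real.exp_lt_exp.2 hsq

/-- The little-o hypothesis is applied at a single large `t`. Monotonicity of `f` and of `(log g) ^
2` carries the bounds at `t` back to all smaller times. -/
theorem theorem2 (f g : ℝ → ℝ) (hf_pos : ∀ x : ℝ, 0 < x → 0 < f x)
    (hg_pos : ∀ x : ℝ, 0 < x → 0 < g x)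
    (hf : SubLogarithmic f)
    (hg : SubLogarithmic fun x : ℝ => Real.log (g x) ^ 2)
    (hfg : f =o[atTop] fun x : ℝ => Real.log x / Real.log (g x) ^ 2) :
    ¬ ∃ A : Algorithm.{u}, AchievesThroughput A f g := by
  rintro ⟨A, hA⟩
  obtain ⟨y, hy, x₁, hfy⟩ := hf.eventually_ge
  obtain ⟨z, hz, x₂, hgz⟩ := hg.eventually_ge
  -- `b ≤ C₁ * f t` and `log R ≤ C₂ * |log (g t)|`
  set C₁ : ℝ := 4 + 1 / y with hC₁
  set C₂ : ℝ := 1 + 3 / √z with hC₂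
  have hC₁0 : 0 < C₁ := by positivity
  have hC₂0 : 0 < C₂ := by positivity
  -- Chosen so that the left side of `hparam` is at most `log t / 2`.
  set ε : ℝ := 1 / (4096 * C₁ * C₂ ^ 2) with hε
  have hε0 : 0 < ε := by positivity
  obtain ⟨t, hft, htx₁, htx₂, ht1⟩ := ((hfg.def hε0).and
    ((eventually_ge_atTop x₁).and ((eventually_ge_atTop x₂).and (eventually_gt_atTop 1)))).exists
  have ht0 : 0 < t := by linarith
  have hlogt : 0 < Real.log t := Real.log_pos ht1
  have hfty := hfy t htx₁
  have hgtz : z ≤ Real.log (g t) ^ 2 := hgz t htx₂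
  -- The absolute value is needed since `g` may be below `1`: monotonicity of `(log g) ^ 2` controls
  -- only `|log g|`, which still yields `g ≤ exp L` up to time `t`.
  set L := |Real.log (g t)| with hL
  have hLsq : Real.log (g t) ^ 2 = L ^ 2 := (sq_abs _).symm
  have hLz : √z ≤ L := by
    rw [hL, ← Real.sqrt_sq_eq_abs]
    exact Real.sqrt_le_sqrt hgtz
  have hL0 : 0 < L := (Real.sqrt_pos.2 hz).trans_le hLz
  have hfL : f t * L ^ 2 ≤ ε * Real.log t := by
    rw [hLsq, Real.norm_of_nonneg (hf_pos t ht0).le, Real.norm_of_nonneg (by positivity),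
      ← mul_div_assoc, le_div_iff₀ (by positivity)] at hft
    exact hft
  set R := ⌈16 * Real.exp L⌉₊ with hR_def
  set b := ⌈4 * f t⌉₊ with hb_def
  have hexpL : 1 ≤ Real.exp L := Real.one_le_exp hL0.le
  have hRge : 16 * Real.exp L ≤ R := Nat.le_ceil _
  have hbge : 4 * f t ≤ b := Nat.le_ceil _
  have hR16 : 16 ≤ R := by
    have : (16 : ℝ) ≤ R := by linarith
    exact_mod_cast this
  have hb1 : 1 ≤ b := Nat.ceil_pos.2 (by linarith)
  have hbC : (b : ℝ) ≤ C₁ * f t := by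
    have h1 := (Nat.ceil_lt_add_one (by linarith : 0 ≤ 4 * f t)).le
    have h2 : 1 ≤ 1 / y * f t := by
      rw [one_div, ← div_eq_inv_mul, one_le_div hy]
      exact hfty
    rw [hC₁]
    linarith
  have hlogR : Real.log R ≤ C₂ * L := by
    have h1 := (Nat.ceil_lt_add_one (by positivity : 0 ≤ 16 * Real.exp L)).le
    have h2 : (R : ℝ) ≤ Real.exp (3 + L) := by
      have h3 : Real.exp 3 = Real.exp 1 * Real.exp 1 * Real.exp 1 := by
        rw [← Real.exp_add, ← Real.exp_add]
        norm_num
      have h4 := Real.exp_one_gt_d9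
      have h5 : (17 : ℝ) ≤ Real.exp 3 := by
        rw [h3]
        calc (17 : ℝ) ≤ 2.7 * 2.7 * 2.7 := by norm_num
          _ ≤ _ := by gcongr <;> linarith
      rw [Real.exp_add]
      nlinarith
    have h6 : Real.log R ≤ 3 + L :=
      (Real.log_le_log (by exact_mod_cast (by omega : 0 < R)) h2).trans_eq (Real.log_exp _)
    have h7 : 3 ≤ 3 / √z * L := by
      rw [div_mul_eq_mul_div, le_div_iff₀ (Real.sqrt_pos.2 hz)]
      gcongr
    rw [hC₂]
    linarith
  have hlogR0 : 0 ≤ Real.log R := Real.log_natCast_nonneg R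
  have hft0 : 0 < f t := hf_pos t ht0
  have hparam : 2048 * (b : ℝ) * Real.log R ^ 2 < Real.log t := by
    calc 2048 * (b : ℝ) * Real.log R ^ 2 ≤ 2048 * (C₁ * f t) * (C₂ * L) ^ 2 := by gcongr
      _ = 2048 * C₁ * C₂ ^ 2 * (f t * L ^ 2) := by ring
      _ ≤ 2048 * C₁ * C₂ ^ 2 * (ε * Real.log t) := by gcongr
      _ = Real.log t / 2 := by rw [hε]; field_simp; norm_num
      _ < Real.log t := by linarith
  obtain ⟨r, hbR, hTt, hexp⟩ := exists_block_parameters hR16 hb1 hparam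
  rw [Real.exp_log ht0] at hTt
  have hMt : ∀ M : ℕ, M ≤ R ^ (8 * r + 1) * b → (M : ℝ) ≤ t := fun M hM =>
    (Nat.cast_le.2 hM).trans hTt
  have hM0 : ∀ M : ℕ, 1 ≤ M → (0 : ℝ) < M := fun M hM => by exact_mod_cast hM
  refine not_achievesThroughput_of_bounds hR16 hb1 hbR (fun M h1 => (hg_pos M (hM0 M h1)).le)
    (fun M h1 h2 => ?_) (fun M h1 h2 => ?_) hexp hA
  · have := hf.monotoneOn (hM0 M h1) ht0 (hMt M h2)
    linarith
  · have h3 : Real.log (g M) ^ 2 ≤ Real.log (g t) ^ 2 :=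
      hg.monotoneOn (hM0 M h1) ht0 (hMt M h2)
    have h4 : Real.log (g M) ≤ L := (le_abs_self _).trans (sq_le_sq.1 h3)
    have h5 : g M ≤ Real.exp L := by
      rw [← Real.exp_log (hg_pos M (hM0 M h1))]
      exact Real.exp_le_exp.2 h4
    linarith
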